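/- Let $a>0$, $\Omega_0=(-a,a)^2\subset\mathbb R^2$, and let $g$ and $\sigma\ge 0$ be real functions on $\mathbb R^2$ with compact supports in $\Omega_0$, $g\in L^2(\Omega_0)$, $\sigma\in L^4(\Omega_0)$. Let $W$ be a real Gaussian white noise on $\mathbb R^2$ and $G_k(x,y)=-\frac{\mathrm i}{4}H_0^{(1)}(k|x-y|)$. Put $k^*=\frac{\pi}{30a}$, let $k\in\{\frac{\pi}{a}x: x\ge 1\}\cup\{k^*\}$, and let $u$ be the mild solution of $\Delta u+k^2u=g+\sigma\dot W$, i.e. a continuous process with $$u(x)=\int_{\Omega_0}G_k(x,y)g(y)\,\mathrm dy+\int_{\Omega_0}G_k(x,y)\sigma(y)\,\mathrm dW_y\quad\text{almost surely, for every }x .$$ Write $\mathbf{Var}(u)=\mathbf{Var}(\operatorname{Re}u)+\mathbf{Var}(\operatorname{Im}u)$. Let $\tau\ge 6$, and let $m\ge 10$ and $1\le j\le m$ be integers. Put $R=6a$ if $k=k^*$ and $R=\tau a$ otherwise, $\lambda_1=\frac12$, and $\lambda_2=-\frac32$ if $k=k^*$, $\lambda_2=\frac12+\frac{\pi}{2kR}$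 otherwise. With $\nu_\mu=\mu\pi/m$ let $z_\ell=\lambda_\ell R(\cos\nu_{2j-1},\sin\nu_{2j-1})$, $\ell=1,2$, let $\partial B_j=\{R(\cos\theta,\sin\theta):\nu_{2j-2}\le\theta\le\nu_{2j}\}$, and let $\|\cdot\|_{j,\infty}$ be the norm of $L^\infty(\partial B_j)$ (with respect to arc length). Let $0<\epsilon<1$, and let $\mathbf E^\epsilon(u)$, $\mathbf E^\epsilon(v_1)$, $\mathbf E^\epsilon(v_2)$ (complex-valued) and $\mathbf E^\epsilon(|u|^2)$ (real-valued) be noisy data on $\partial B_j$ satisfying, for $\ell=1,2$, $$\big\||\mathbf E^\epsilon(u)|-|\mathbf E(u)|\big\|_{j,\infty}\le\epsilon\|\mathbf E(u)\|_{j,\infty},\qquad \big\||\mathbf E^\epsilon(v_\ell)|-|\mathbf E(\hat v_\ell)|\big\|_{j,\infty}\le\epsilon\|\mathbf E(\hat v_\ell)\|_{j,\infty},$$ $$\big\|\mathbf E^\epsilon(|u|^2)-\mathbf E(|u|^2)\big\|_{j,\infty}\le\epsilon\|\mathbf E(|u|^2)\|_{j,\infty},$$ where $\hat v_\ell=u+c^\epsilon_\ell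 G_k(\cdot,z_\ell)$ and $c^\epsilon_\ell=\|\mathbf E^\epsilon(u)\|_{j,\infty}/\|G_k(\cdot,z_\ell)\|_{j,\infty}$. Then the recovered variance $\mathbf{Var}^\epsilon(u):=\mathbf E^\epsilon(|u|^2)-|\mathbf E^\epsilon(u)|^2$ satisfies $$\|\mathbf{Var}^\epsilon(u)-\mathbf{Var}(u)\|_{j,\infty}\le\epsilon\|\mathbf{Var}(u)\|_{j,\infty}+C'_\epsilon\|\mathbf E(u)\|_{j,\infty}^2,$$ where $$C'_\epsilon=\epsilon(3+\epsilon C_\epsilon),\qquad C_\epsilon=\frac{2.5(2+\epsilon)^2(3+\epsilon)+20}{1-\epsilon}.$$ -/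

import Mathlib

open MeasureTheory ProbabilityTheory
open scoped ENNReal NNReal

noncomputable section

namespace PhaseRetrieval

/-! ### Geometry -/

abbrev Plane : Type := EuclideanSpace ℝ (Fin 2)

/-- The point `(r cos θ, r sin θ)`. -/
def polar (r θ : ℝ) : Plane := !₂[r * Real.cos θ, r * Real.sin θ]

/-- The open square `(-a, a)²`. -/
def sourceSquare (a : ℝ) : Set Plane := {y | ∀ i, y i ∈ Set.Ioo (-a) a}

/-- The small wavenumber `k* = π / (30 a)`. -/
def kStar (a : ℝ) : ℝ := Real.pi / (30 * a)

/-- The admissible wavenumbers `{(π / a) x : x ≥ 1} ∪ {k*}`. -/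
def admissible (a : ℝ) : Set ℝ :=
  {k | ∃ x : ℝ, 1 ≤ x ∧ k = Real.pi / a * x} ∪ {kStar a}

/-- The radius of the measurement circle: `6 a` if `k = k*`, and `τ a` otherwise. -/
def radius (a τ k : ℝ) : ℝ :=
  open Classical in if k = kStar a then 6 * a else τ * a

/-- The position parameters `λ_{j,1}` (index `0`) and `λ_{j,2}` (index `1`) of the reference
sources: `λ_{j,1} = 1/2`, and `λ_{j,2} = -3/2` if `k = k*`, `λ_{j,2} = 1/2 + π / (2 k R)`
otherwise. -/
def lam (a τ k : ℝ) : Fin 2 → ℝ :=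
  open Classical in
  ![1 / 2, if k = kStar a then -3 / 2 else 1 / 2 + Real.pi / (2 * k * radius a τ k)]

/-- The angles `ν_μ = μ π / m`. -/
def nu (m : ℕ) (μ : ℝ) : ℝ := μ * Real.pi / m

/-- The `j`-th arc `∂B_j` of the circle of radius `R`. -/
def arc (R : ℝ) (m j : ℕ) : Set Plane :=
  polar R '' Set.Icc (nu m (2 * j - 2)) (nu m (2 * j))

/-- The reference points `z_{j,1}` (index `0`) and `z_{j,2}` (index `1`). -/
def refPoint (a τ k : ℝ) (m j : ℕ) (l : Fin 2) : Plane :=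
  polar (lam a τ k l * radius a τ k) (nu m (2 * j - 1))

/-- The norm `‖·‖_{L^∞(S)}` of a function on a curve `S`, with respect to arc length
(one-dimensional Hausdorff measure); it takes values in `[0, ∞]`. -/
def supNorm {F : Type*} [NormedAddCommGroup F] (S : Set Plane) (f : Plane → F) : ℝ≥0∞ :=
  eLpNorm f ∞ ((Measure.hausdorffMeasure 1 : Measure Plane).restrict S)

/-! ### The Green function -/

/-- The Bessel function `J₀`. -/
def besselJ0 (t : ℝ) : ℝ :=
  ∑' p : ℕ, (-1 : ℝ) ^ p / (p.factorial : ℝ) ^ 2 * (t / 2) ^ (2 * p)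

/-- The Bessel function `Y₀` on `(0, ∞)`. The term `p = 0` of the series is zero. -/
def besselY0 (t : ℝ) : ℝ :=
  2 / Real.pi * besselJ0 t * (Real.log (t / 2) + Real.eulerMascheroniConstant) -
    2 / Real.pi *
      ∑' p : ℕ, (-1 : ℝ) ^ p * (harmonic p : ℝ) / (p.factorial : ℝ) ^ 2 * (t / 2) ^ (2 * p)

/-- The Hankel function `H₀⁽¹⁾ = J₀ + i Y₀` on `(0, ∞)`. -/
def hankel (t : ℝ) : ℂ := besselJ0 t + Complex.I * besselY0 t

/-- The Green function `G_k(x, y) = -(i/4) H₀⁽¹⁾(k |x - y|)`. -/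
def green (k : ℝ) (x y : Plane) : ℂ := -(Complex.I / 4) * hankel (k * ‖x - y‖)

/-! ### White noise and the radiated field -/

section Random

variable {Ω : Type*} [MeasurableSpace Ω]

/-- `W` is a (real, Gaussian) white noise on the plane: a linear family of random variables
indexed by `L²(ℝ²)`, with `W h` centered Gaussian of variance `‖h‖²`. By polarization,
`E[W h · W h'] = ⟪h, h'⟫`, and the family is jointly Gaussian. -/
structure IsWhiteNoise (W : Lp ℝ 2 (volume : Measure Plane) → Ω → ℝ) (P : Measure Ω) :
    Prop where
  linear : ∀ (s t : ℝ) (h h' : Lp ℝ 2 (volume : Measure Plane)),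
    ∀ᵐ ω ∂P, W (s • h + t • h') ω = s * W h ω + t * W h' ω
  gaussian : ∀ h, HasLaw (W h) (gaussianReal 0 (‖h‖₊ ^ 2)) P

/-- The stochastic integral `∫ f dW` of a real function `f ∈ L²(ℝ²)`. -/
def wienerIntegral (W : Lp ℝ 2 (volume : Measure Plane) → Ω → ℝ) (f : Plane → ℝ) (ω : Ω) : ℝ :=
  open Classical in
  if hf : MemLp f 2 (volume : Measure Plane) then W (hf.toLp f) ω else 0

/-- The stochastic integral `∫_D f dW` of a complex function `f` over a set `D`. -/
def wienerIntegralC (W : Lp ℝ 2 (volume : Measure Plane) → Ω → ℝ) (D : Set Plane)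
    (f : Plane → ℂ) (ω : Ω) : ℂ :=
  wienerIntegral W (D.indicator fun y => (f y).re) ω +
    Complex.I * wienerIntegral W (D.indicator fun y => (f y).im) ω

/-- `u` is the mild solution, for the wavenumber `k`, of the Helmholtz equation with random
source `g + σ Ẇ`: a process on the plane with continuous paths such that, for every `x`,
almost surely `u(x) = ∫_{Ω₀} G_k(x, y) g(y) dy + ∫_{Ω₀} G_k(x, y) σ(y) dW_y`. -/
structure IsMildSolution (P : Measure Ω) (W : Lp ℝ 2 (volume : Measure Plane) → Ω → ℝ)
    (a : ℝ) (g σ : Plane → ℝ) (k : ℝ) (u : Plane → Ω → ℂ) : Prop where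
  continuous : ∀ᵐ ω ∂P, Continuous fun x => u x ω
  eq : ∀ x, ∀ᵐ ω ∂P, u x ω =
    (∫ y in sourceSquare a, green k x y * (g y : ℂ)) +
      wienerIntegralC W (sourceSquare a) (fun y => green k x y * (σ y : ℂ)) ω

/-- The expectation `E(u)`, a function on the plane. -/
def mean (P : Measure Ω) (u : Plane → Ω → ℂ) (x : Plane) : ℂ := ∫ ω, u x ω ∂P

/-- The expectation `E(|u|²)`. -/
def meanSq (P : Measure Ω) (u : Plane → Ω → ℂ) (x : Plane) : ℝ := ∫ ω, ‖u x ω‖ ^ 2 ∂P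

/-- The variance `Var(u) = Var(Re u) + Var(Im u)`. -/
def complexVar (P : Measure Ω) (u : Plane → Ω → ℂ) (x : Plane) : ℝ :=
  variance (fun ω => (u x ω).re) P + variance (fun ω => (u x ω).im) P

/-! ### Noisy data -/

/-- The noisy scaling factor `c^ε = ‖E^ε(u)‖_{L^∞(S)} / ‖G_k(·, z)‖_{L^∞(S)}`. -/
def noisyScale (S : Set Plane) (k : ℝ) (z : Plane) (Eu : Plane → ℂ) : ℝ :=
  (supNorm S Eu / supNorm S (fun x => green k x z)).toReal

/-- The field `v̂ = u + c^ε G_k(·, z)` produced by the source together with a reference source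
of strength `c^ε` at `z`. -/
def refField (S : Set Plane) (k : ℝ) (z : Plane) (Eu : Plane → ℂ) (u : Plane → Ω → ℂ)
    (x : Plane) (ω : Ω) : ℂ :=
  u x ω + (noisyScale S k z Eu : ℂ) * green k x z

/-- The noise model on the arc `S` with reference points `z`, at relative level `ε`, for the
noisy values `Eu` of `E(u)`, `Ev l` of `E(v̂_l)` and `EuSq` of `E(|u|²)`. Of `Eu` and `Ev l`
only the moduli are measured and compared with the true ones. The phase of `Eu` is not
restricted: `Eu` may be the mean recovered from the linear system of phase retrieval, or any
other function with the measured modulus. -/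
structure NoiseBound (P : Measure Ω) (S : Set Plane) (k : ℝ) (z : Fin 2 → Plane) (ε : ℝ)
    (u : Plane → Ω → ℂ) (Eu : Plane → ℂ) (Ev : Fin 2 → Plane → ℂ) (EuSq : Plane → ℝ) :
    Prop where
  mean_u : supNorm S (fun x => ‖Eu x‖ - ‖mean P u x‖) ≤
    ENNReal.ofReal ε * supNorm S (mean P u)
  mean_v : ∀ l, supNorm S (fun x => ‖Ev l x‖ - ‖mean P (refField S k (z l) Eu u) x‖) ≤
    ENNReal.ofReal ε * supNorm S (mean P (refField S k (z l) Eu u))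
  meanSq_u : supNorm S (fun x => EuSq x - meanSq P u x) ≤
    ENNReal.ofReal ε * supNorm S (meanSq P u)

end Random

/-- The recovered variance `Var^ε(u) = E^ε(|u|²) - |E^ε(u)|²`. -/
def noisyVar (Eu : Plane → ℂ) (EuSq : Plane → ℝ) (x : Plane) : ℝ := EuSq x - ‖Eu x‖ ^ 2

/-- `C_ε = (2.5 (2 + ε)² (3 + ε) + 20) / (1 - ε)`. -/
def stabConst (ε : ℝ) : ℝ := (5 / 2 * (2 + ε) ^ 2 * (3 + ε) + 20) / (1 - ε)

/-- `C'_ε = ε (3 + ε C_ε)`. -/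
def stabConstVar (ε : ℝ) : ℝ := ε * (3 + ε * stabConst ε)

end PhaseRetrieval

end

open PhaseRetrieval

namespace PhaseRetrieval

/-! ### Square integrability of the field -/

section Field

variable {Ω : Type*} [MeasurableSpace Ω] {P : Measure Ω}
  {W : Lp ℝ 2 (volume : Measure Plane) → Ω → ℝ}

/-! Since `Var(u) = E(|u|²) - |E(u)|²`, the error of the recovered variance is the error of the
second moment minus that of the squared modulus of the mean. With `M = ‖E(u)‖`, the first is at most
`ε ‖E(|u|²)‖ ≤ ε (‖Var(u)‖ + M²)`. The second is at most `εM (εM + 2M)`, because only the modulus of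
the noisy mean enters. The sum is `ε ‖Var(u)‖ + ε (3 + ε) M²` (`supNorm_noisyVar_sub_le`), and `ε (3
+ ε) ≤ C'_ε` since `C_ε ≥ 1`. -/

lemma IsWhiteNoise.memLp_two (hW : IsWhiteNoise W P) (h : Lp ℝ 2 (volume : Measure Plane)) :
    MemLp (W h) 2 P := by
  have hlaw := hW.gaussian h
  have hid : MemLp id 2 (P.map (W h)) := by
    rw [hlaw.map_eq]
    exact memLp_id_gaussianReal 2
  exact hid.comp_of_map hlaw.aemeasurable

lemma IsWhiteNoise.memLp_wienerIntegral (hW : IsWhiteNoise W P) (f : Plane → ℝ) :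
    MemLp (wienerIntegral W f) 2 P := by
  -- The default value `0` off `L²` is square integrable too, so no estimate of the Green function
  -- is needed.
  by_cases hf : MemLp f 2 (volume : Measure Plane)
  · have : wienerIntegral W f = W (hf.toLp f) := by
      funext ω
      simp [wienerIntegral, hf]
    exact this ▸ hW.memLp_two _
  · have : wienerIntegral W f = 0 := by
      funext ω
      simp [wienerIntegral, hf]
    exact this ▸ MemLp.zero

lemma IsWhiteNoise.memLp_wienerIntegralC (hW : IsWhiteNoise W P) (D : Set Plane)
    (f : Plane → ℂ) : MemLp (wienerIntegralC W D f) 2 P := by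
  have hofReal (h : Plane → ℝ) : MemLp (fun ω => (wienerIntegral W h ω : ℂ)) 2 P :=
    (hW.memLp_wienerIntegral h).ofReal
  unfold wienerIntegralC
  exact (hofReal _).add ((hofReal _).const_mul Complex.I)

lemma IsMildSolution.memLp_two [IsProbabilityMeasure P] (hW : IsWhiteNoise W P) {a k : ℝ}
    {g σ : Plane → ℝ} {u : Plane → Ω → ℂ} (hu : IsMildSolution P W a g σ k u) (x : Plane) :
    MemLp (u x) 2 P := by
  refine MemLp.ae_eq (Filter.EventuallyEq.symm (hu.eq x)) ?_
  exact (memLp_const (∫ y in sourceSquare a, green k x y * (g y : ℂ))).add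
    (hW.memLp_wienerIntegralC (sourceSquare a) fun y => green k x y * (σ y : ℂ))

/-- Square integrability makes `E(X²) - E(X)²` valid for the real and imaginary parts separately;
the two identities are added. -/
lemma complexVar_eq_meanSq_sub [IsProbabilityMeasure P] {u : Plane → Ω → ℂ} {x : Plane}
    (hu : MemLp (u x) 2 P) :
    complexVar P u x = meanSq P u x - ‖mean P u x‖ ^ 2 := by
  have hint : Integrable (u x) P := hu.integrable one_le_two
  have hre : MemLp (fun ω => (u x ω).re) 2 P := hu.re
  have him : MemLp (fun ω => (u x ω).im) 2 P := hu.im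
  have h_re : ∫ ω, (u x ω).re ∂P = (∫ ω, u x ω ∂P).re := integral_re hint
  have h_im : ∫ ω, (u x ω).im ∂P = (∫ ω, u x ω ∂P).im := integral_im hint
  have hsq : ∫ ω, ‖u x ω‖ ^ 2 ∂P = ∫ ω, (u x ω).re ^ 2 ∂P + ∫ ω, (u x ω).im ^ 2 ∂P := by
    rw [← integral_add hre.integrable_sq him.integrable_sq]
    refine integral_congr_ae (.of_forall fun ω => ?_)
    simp only [Complex.sq_norm, Complex.normSq_apply]
    ring
  rw [complexVar, meanSq, mean, variance_eq_sub hre, variance_eq_sub him, hsq,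
    Complex.sq_norm, Complex.normSq_apply]
  simp only [Pi.pow_apply, h_re, h_im]
  ring

end Field

/-! ### Perturbation of the variance -/

section Norm

variable {S : Set Plane}

lemma ae_enorm_le_supNorm {F : Type*} [NormedAddCommGroup F] (f : Plane → F) :
    ∀ᵐ x ∂(Measure.hausdorffMeasure 1 : Measure Plane).restrict S, ‖f x‖ₑ ≤ supNorm S f := by
  simpa only [supNorm, eLpNorm_exponent_top] using ae_le_eLpNormEssSup

lemma supNorm_le_of_ae {F : Type*} [NormedAddCommGroup F] {f : Plane → F} {C : ℝ≥0∞}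
    (h : ∀ᵐ x ∂(Measure.hausdorffMeasure 1 : Measure Plane).restrict S, ‖f x‖ₑ ≤ C) :
    supNorm S f ≤ C := by
  rw [supNorm, eLpNorm_exponent_top]
  exact essSup_le_of_ae_le C h

/-- Writing `s + t = (s - t) + 2t` leaves only the error and the exact value `t`, both controlled by
the noise model. -/
lemma enorm_sq_sub_sq_le (s t : ℝ) :
    ‖s ^ 2 - t ^ 2‖ₑ ≤ ‖s - t‖ₑ * (‖s - t‖ₑ + 2 * ‖t‖ₑ) := by
  have h : s ^ 2 - t ^ 2 = (s - t) * ((s - t) + (t + t)) := by ring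
  rw [h, enorm_mul, two_mul]
  gcongr
  exact (enorm_add_le _ _).trans (by gcongr; exact enorm_add_le _ _)

/-- If second moments and moduli of means are known up to relative errors `ε`, then so is the
difference of the second moment and the squared modulus of the mean, up to an additional
multiple of the squared norm of the mean. -/
lemma supNorm_noisyVar_sub_le {ε : ℝ≥0∞} {M Eu : Plane → ℂ} {V Q EuSq : Plane → ℝ}
    (hV : ∀ x, V x = Q x - ‖M x‖ ^ 2)
    (hM : supNorm S (fun x => ‖Eu x‖ - ‖M x‖) ≤ ε * supNorm S M)
    (hQ : supNorm S (fun x => EuSq x - Q x) ≤ ε * supNorm S Q) :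
    supNorm S (fun x => noisyVar Eu EuSq x - V x) ≤
      ε * supNorm S V + ε * (3 + ε) * supNorm S M ^ 2 := by
  -- The noise in `Q` is relative to `Q` itself; this trades it for `V`, at the cost of one `M²`.
  have hQV : supNorm S Q ≤ supNorm S V + supNorm S M ^ 2 := by
    refine supNorm_le_of_ae ?_
    filter_upwards [ae_enorm_le_supNorm (S := S) V, ae_enorm_le_supNorm (S := S) M]
      with x h₁ h₂
    calc ‖Q x‖ₑ = ‖V x + ‖M x‖ ^ 2‖ₑ := by rw [hV]; ring_nf
      _ ≤ ‖V x‖ₑ + ‖M x‖ₑ ^ 2 :=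
        (enorm_add_le _ _).trans_eq (by rw [enorm_pow, enorm_norm])
      _ ≤ _ := by gcongr
  refine supNorm_le_of_ae ?_
  filter_upwards [ae_enorm_le_supNorm (S := S) (fun x => EuSq x - Q x),
    ae_enorm_le_supNorm (S := S) (fun x => ‖Eu x‖ - ‖M x‖), ae_enorm_le_supNorm (S := S) M]
    with x h₁ h₂ h₃
  have hx : noisyVar Eu EuSq x - V x = (EuSq x - Q x) - (‖Eu x‖ ^ 2 - ‖M x‖ ^ 2) := by
    rw [noisyVar, hV]; ring
  calc ‖noisyVar Eu EuSq x - V x‖ₑ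
      ≤ ‖EuSq x - Q x‖ₑ + ‖‖Eu x‖ ^ 2 - ‖M x‖ ^ 2‖ₑ := by rw [hx]; exact enorm_sub_le
    _ ≤ ‖EuSq x - Q x‖ₑ + ‖‖Eu x‖ - ‖M x‖‖ₑ * (‖‖Eu x‖ - ‖M x‖‖ₑ + 2 * ‖M x‖ₑ) := by
      gcongr
      simpa only [enorm_norm] using enorm_sq_sub_sq_le ‖Eu x‖ ‖M x‖
    -- The coefficient `3 + ε` of `ε M²` arises as `1` from `hQV` plus `ε + 2` from the squares.
    _ ≤ ε * (supNorm S V + supNorm S M ^ 2) +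
        ε * supNorm S M * (ε * supNorm S M + 2 * supNorm S M) := by
      have h₄ := h₁.trans (hQ.trans (mul_le_mul_right hQV ε))
      have h₅ := h₂.trans hM
      gcongr
    _ = _ := by ring

end Norm

/-- The summand `20` alone exceeds the denominator `1 - ε`. -/
lemma one_le_stabConst {ε : ℝ} (hε : 0 ≤ ε) (hε₁ : ε < 1) : 1 ≤ stabConst ε := by
  rw [stabConst, le_div_iff₀ (by linarith)]
  have : 0 ≤ 5 / 2 * (2 + ε) ^ 2 * (3 + ε) := by positivity
  linarith

lemma le_stabConstVar {ε : ℝ} (hε : 0 ≤ ε) (hε₁ : ε < 1) : ε * (3 + ε) ≤ stabConstVar ε := by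
  have := le_mul_of_one_le_right hε (one_le_stabConst hε hε₁)
  rw [stabConstVar]
  gcongr

end PhaseRetrieval

theorem theorem2p3 {Ω : Type*} [MeasurableSpace Ω] (P : Measure Ω) [IsProbabilityMeasure P]
    (W : Lp ℝ 2 (volume : Measure Plane) → Ω → ℝ) (hW : IsWhiteNoise W P)
    (a : ℝ) (ha : 0 < a)
    (g σ : Plane → ℝ) (hσ : ∀ y, 0 ≤ σ y)
    (hg_compact : HasCompactSupport g) (hg_supp : tsupport g ⊆ sourceSquare a)
    (hσ_compact : HasCompactSupport σ) (hσ_supp : tsupport σ ⊆ sourceSquare a)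
    (hg : MemLp g 2 (volume.restrict (sourceSquare a)))
    (hσ4 : MemLp σ 4 (volume.restrict (sourceSquare a)))
    (τ : ℝ) (hτ : 6 ≤ τ) (k : ℝ) (hk : k ∈ admissible a)
    (u : Plane → Ω → ℂ) (hu : IsMildSolution P W a g σ k u)
    (m : ℕ) (hm : 10 ≤ m) (j : ℕ) (hj₁ : 1 ≤ j) (hjm : j ≤ m)
    (ε : ℝ) (hε : 0 < ε) (hε₁ : ε < 1)
    (Eu : Plane → ℂ) (Ev : Fin 2 → Plane → ℂ) (EuSq : Plane → ℝ)
    (hnoise : NoiseBound P (arc (radius a τ k) m j) k (refPoint a τ k m j) ε u Eu Ev EuSq) :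
    supNorm (arc (radius a τ k) m j) (fun x => noisyVar Eu EuSq x - complexVar P u x) ≤
      ENNReal.ofReal ε * supNorm (arc (radius a τ k) m j) (complexVar P u) +
        ENNReal.ofReal (stabConstVar ε) *
          supNorm (arc (radius a τ k) m j) (mean P u) ^ 2 := by
  refine (supNorm_noisyVar_sub_le
    (fun x => complexVar_eq_meanSq_sub (hu.memLp_two hW x)) hnoise.mean_u hnoise.meanSq_u).trans ?_
  gcongr
  calc ENNReal.ofReal ε * (3 + ENNReal.ofReal ε) = ENNReal.ofReal (ε * (3 + ε)) := by
        rw [ENNReal.ofReal_mul hε.le, ENNReal.ofReal_add (by norm_num) hε.le,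
          ENNReal.ofReal_ofNat]
    _ ≤ _ := ENNReal.ofReal_le_ofReal (le_stabConstVar hε.le hε₁)
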